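/- Let $\mathbb K$ be a field and let $\mathcal T$ be a $\mathbb K$-linear triangulated category. For $l\ge -1$ let $N\mathbb P^l=D^b(\mathrm{Rep}_{\mathbb K}(K(l+1)))$ be the bounded derived category of finite-dimensional representations of the Kronecker quiver $K(l+1)$ with two vertices and $l+1$ parallel arrows. Let $C_l(\mathcal T)$ be the set of equivalence classes of fully faithful exact $\mathbb K$-linear functors $F:N\mathbb P^l\to\mathcal T$, where $F\sim F'$ iff $F\circ\alpha\cong F'$ (as exact functors) for some exact auto-equivalence $\alpha$ of $N\mathbb P^l$. The elements of $C_l(\mathcal T)$ are called non-commutative curves of genus $l$ in $\mathcal T$; a curve $\mathcal A=[F]$ determines the full subcategory $\mathrm{Im}(F)\subset\mathcal T$ (the essential image), and one writes $E\in\mathcal A$ for $E\in\mathrm{Im}(F)$. An object $E$ of a $\mathbb K$-linear triangulated category is exceptional if $\mathrm{Hom}(E,E)=\mathbb K$ and $\mathrm{Hom}(E,E[i])=0$ for all $i\ne 0$. Let $\mathrm{Stab}(\mathcal T)$ be the space of locally finite Bridgeland stability conditions on $\mathcal T$ with Bridgeland's topology, and for $\sigma\in\mathrm{Stab}(\mathcal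 T)$ let $\sigma^{ss}$ be the set of $\sigma$-semistable objects. Let $\mathcal E$ be a set of exceptional objects of $N\mathbb P^l$ such that every exceptional object of $N\mathbb P^l$ is isomorphic to a shift of exactly one element of $\mathcal E$. A curve $\mathcal A\in C_l(\mathcal T)$ is called $\sigma$-stable, written $\mathcal A\in C_{l,\sigma\sigma}(\mathcal T)$, if $\mathcal A=[F]$ for some $F$ with $F(X)\in\sigma^{ss}$ for all $X\in\mathcal E$. Then for every $l\ge -1$ and every $\mathcal A\in C_l(\mathcal T)$ the set $\{\sigma\in\mathrm{Stab}(\mathcal T):\mathcal A\in C_{l,\sigma\sigma}(\mathcal T)\}$ is closed in $\mathrm{Stab}(\mathcal T)$. Moreover, for every exceptional object $E\in\mathcal A$ the set $\{\sigma\in\mathrm{Stab}(\mathcal T):E\in\sigma^{ss}\}$ is closed, and $$\{\sigma\in\mathrm{Stab}(\mathcal T):\mathcal A\in C_{l,\sigma\sigma}(\mathcal T)\}=\bigcap_{E\in\mathcal A\ \text{exceptional}}\{\sigma\in\mathrm{Stab}(\mathcal T):E\in\sigma^{ss}\}.$$ -/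

import Mathlib

open CategoryTheory CategoryTheory.Limits CategoryTheory.Pretriangulated

universe w u v u' v'

/-! ## Bridgeland stability conditions on a triangulated category -/

section Stability

variable (T : Type u) [Category.{v} T] [Preadditive T] [HasZeroObject T] [HasShift T ℤ]
  [∀ n : ℤ, (shiftFunctor T n).Additive] [Pretriangulated T]

/-- The subgroup of relations `[X₂] = [X₁] + [X₃]`, one for every distinguished triangle. -/
def triangleRelations : AddSubgroup (FreeAbelianGroup T) :=
  AddSubgroup.closure {r | ∃ Δ : Triangle T, Δ ∈ distTriang T ∧
    r = FreeAbelianGroup.of Δ.obj₂ - (FreeAbelianGroup.of Δ.obj₁ + FreeAbelianGroup.of Δ.obj₃)}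

/-- The Grothendieck group `K₀(T)` of a triangulated category. -/
abbrev K0 : Type u := FreeAbelianGroup T ⧸ triangleRelations T

variable {T}

/-- The class `[X]` in `K₀(T)`. -/
def K0.mk (X : T) : K0 T := QuotientAddGroup.mk (FreeAbelianGroup.of X)

/-- A Harder-Narasimhan filtration of `E` with respect to a family of subcategories `P φ`:
objects `0 = E₀, E₁, …, E_{n+1} = E`, phases `φ₀ > φ₁ > … > φ_n`, and distinguished triangles
`E_i ⟶ E_{i+1} ⟶ A_i ⟶ E_i[1]` with `A_i` a nonzero object of `P φ_i`. -/
structure HNFiltration (P : ℝ → ObjectProperty T) (E : T) where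
  n : ℕ
  obj : Fin (n + 2) → T
  zero : IsZero (obj 0)
  top : obj (Fin.last (n + 1)) ≅ E
  phase : Fin (n + 1) → ℝ
  phase_anti : StrictAnti phase
  factor : Fin (n + 1) → T
  factor_mem : ∀ i, P (phase i) (factor i)
  factor_ne : ∀ i, ¬ IsZero (factor i)
  incl : ∀ i : Fin (n + 1), obj i.castSucc ⟶ obj i.succ
  proj : ∀ i : Fin (n + 1), obj i.succ ⟶ factor i
  conn : ∀ i : Fin (n + 1), factor i ⟶ (obj i.castSucc)⟦(1 : ℤ)⟧
  dist : ∀ i, Triangle.mk (incl i) (proj i) (conn i) ∈ distTriang T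

variable (T) in
/-- A slicing of a triangulated category. -/
structure Slicing where
  P : ℝ → ObjectProperty T
  /-- each `P φ` is a strictly full additive subcategory -/
  closedIso : ∀ φ, (P φ).IsClosedUnderIsomorphisms
  additive : ∀ φ, (P φ).IsClosedUnderFiniteProducts
  /-- `P(φ)[1] = P(φ + 1)` -/
  shift : ∀ (φ : ℝ) (X : T), P (φ + 1) (X⟦(1 : ℤ)⟧) ↔ P φ X
  hom_zero : ∀ (φ ψ : ℝ) (X Y : T), ψ < φ → P φ X → P ψ Y → ∀ f : X ⟶ Y, f = 0
  exists_hn : ∀ E : T, ¬ IsZero E → Nonempty (HNFiltration P E)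

namespace Slicing

variable (S : Slicing T)

open Classical in
/-- A chosen Harder-Narasimhan filtration of a nonzero object (it is unique up to
isomorphism). -/
noncomputable def hn (E : T) (hE : ¬ IsZero E) : HNFiltration S.P E :=
  Classical.choice (S.exists_hn E hE)

open Classical in
/-- `φ⁺(E)`, the largest phase in the Harder-Narasimhan filtration of `E ≠ 0`. -/
noncomputable def phiPlus (E : T) : ℝ :=
  if hE : IsZero E then 0 else (S.hn E hE).phase 0

open Classical in
/-- `φ⁻(E)`, the smallest phase in the Harder-Narasimhan filtration of `E ≠ 0`. -/
noncomputable def phiMinus (E : T) : ℝ :=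
  if hE : IsZero E then 0 else (S.hn E hE).phase (Fin.last _)

/-- The subcategory `P((a, b))`: the zero objects and the objects all of whose
Harder-Narasimhan phases lie in `(a, b)`. -/
def interval (a b : ℝ) : ObjectProperty T := fun E =>
  IsZero E ∨ ∃ F : HNFiltration S.P E, ∀ i, F.phase i ∈ Set.Ioo a b

/-- The strict subobjects of `B` in `P((a, b))`, i.e. those represented by kernels in
`P((a, b))`, ordered by inclusion. -/
abbrev StrictSubobject (a b : ℝ) (B : (S.interval a b).FullSubcategory) : Type (max u v) :=
  {A : Subobject B // Nonempty (NormalMono A.arrow)}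

/-- A slicing is locally finite if for some `η > 0` all the quasi-abelian categories
`P((t - η, t + η))` are of finite length, i.e. have the ascending and the descending chain
condition on strict subobjects. (Such a category is known to be quasi-abelian if `2 η < 1`;
shrinking `η` is harmless.) -/
def IsLocallyFinite : Prop :=
  ∃ η : ℝ, 0 < η ∧ η < 1 / 2 ∧ ∀ (t : ℝ) (B : (S.interval (t - η) (t + η)).FullSubcategory),
    WellFoundedGT (S.StrictSubobject (t - η) (t + η) B) ∧
      WellFoundedLT (S.StrictSubobject (t - η) (t + η) B)

/-- Bridgeland's generalized metric
`d(P, Q) = sup_{E ≠ 0} max (|φ⁻_P(E) - φ⁻_Q(E)|, |φ⁺_P(E) - φ⁺_Q(E)|) ∈ [0, ∞]`. -/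
noncomputable def dist (S S' : Slicing T) : ENNReal :=
  ⨆ (E : T) (_ : ¬ IsZero E), ENNReal.ofReal
    (max |S.phiMinus E - S'.phiMinus E| |S.phiPlus E - S'.phiPlus E|)

end Slicing

variable (T) in
/-- A locally finite stability condition `σ = (Z, P)`; the type of these is `Stab(T)`. -/
structure Stab where
  slicing : Slicing T
  Z : K0 T →+ ℂ
  compat : ∀ (t : ℝ) (A : T), slicing.P t A → ¬ IsZero A →
    ∃ m : ℝ, 0 < m ∧ Z (K0.mk A) = m * Complex.exp (Complex.I * Real.pi * t)
  locallyFinite : slicing.IsLocallyFinite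

namespace Stab

/-- The set `σ^ss` of `σ`-semistable objects: the nonzero objects of the `P t`. -/
def semistable (σ : Stab T) : Set T := {X | ¬ IsZero X ∧ ∃ t : ℝ, σ.slicing.P t X}

/-- The generalized norm `‖U‖_σ = sup { |U(E)| / |Z(E)| : E ∈ σ^ss } ∈ [0, ∞]`. -/
noncomputable def seminorm (σ : Stab T) (U : K0 T →+ ℂ) : ENNReal :=
  ⨆ E ∈ σ.semistable, ENNReal.ofReal (‖U (K0.mk E)‖ / ‖σ.Z (K0.mk E)‖)

/-- Bridgeland's basic neighbourhoods
`B_ε(σ) = {τ = (W, Q) : ‖W - Z‖_σ < sin (π ε) and d(P, Q) < ε}`. -/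
def ball (σ : Stab T) (ε : ℝ) : Set (Stab T) :=
  {τ | σ.seminorm (τ.Z - σ.Z) < ENNReal.ofReal (Real.sin (Real.pi * ε)) ∧
    σ.slicing.dist τ.slicing < ENNReal.ofReal ε}

/-- The topology of `Stab(T)`, generated by the sets `B_ε(σ)`, `0 < ε < 1/8`. -/
instance : TopologicalSpace (Stab T) :=
  TopologicalSpace.generateFrom
    {B | ∃ (σ : Stab T) (ε : ℝ), 0 < ε ∧ ε < 1 / 8 ∧ B = σ.ball ε}

end Stab

end Stability

/-! ## Exceptional objects -/

section Exceptional

variable (K : Type w) [Field K] {T : Type u} [Category.{v} T] [Preadditive T] [HasShift T ℤ]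
  [Linear K T]

/-- `Hom(E, E) = K` and `Hom(E, E[i]) = 0` for `i ≠ 0`. -/
def IsExceptional (E : T) : Prop :=
  Module.finrank K (E ⟶ E) = 1 ∧ ∀ i : ℤ, i ≠ 0 → ∀ f : E ⟶ E⟦i⟧, f = 0

/-- `𝓔` consists of exceptional objects, and every exceptional object is isomorphic to a shift
of exactly one member of `𝓔`. -/
def IsExceptionalSystem (𝓔 : Set T) : Prop :=
  (∀ Y ∈ 𝓔, IsExceptional K Y) ∧
    ∀ X : T, IsExceptional K X → ∃! Y : T, Y ∈ 𝓔 ∧ ∃ k : ℤ, Nonempty (X ≅ Y⟦k⟧)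

end Exceptional

/-! ## The categories `N𝐏^l` -/

section Kronecker

/-- The vertices of the Kronecker quiver with `m` arrows. -/
inductive Kronecker (m : ℕ) : Type
  | source
  | target

/-- The Kronecker quiver `K(m)`: `m` parallel arrows from the first vertex to the second. -/
instance (m : ℕ) : Quiver.{0} (Kronecker m) where
  Hom
    | .source, .target => Fin m
    | _, _ => Empty

variable (K : Type w) [Field K]

/-- Finite-dimensional `K`-representations of a quiver: functors from its free category to
finite-dimensional vector spaces. -/
abbrev QuiverRep (Q : Type) [Quiver.{0} Q] := Paths Q ⥤ FGModuleCat.{w} K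

noncomputable instance (Q : Type) [Quiver.{0} Q] : HasDerivedCategory (QuiverRep K Q) :=
  HasDerivedCategory.standard _

/-- The bounded derived category `D^b(Rep_K(Q))`. -/
abbrev BoundedDerived (Q : Type) [Quiver.{0} Q] :=
  (DerivedCategory.TStructure.t (C := QuiverRep K Q)).bounded.FullSubcategory

/-- `N𝐏^l = D^b(Rep_K(K(l + 1)))`, to be used for `l ≥ -1`. -/
abbrev NP (l : ℤ) := BoundedDerived K (Kronecker (l + 1).toNat)

end Kronecker

/-! ## Non-commutative curves -/

section Curves

variable (K : Type w) [Field K]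
  (A : Type u') [Category.{v'} A] [Preadditive A] [HasZeroObject A] [HasShift A ℤ]
  [∀ n : ℤ, (shiftFunctor A n).Additive] [Pretriangulated A] [Linear K A]
  (T : Type u) [Category.{v} T] [Preadditive T] [HasZeroObject T] [HasShift T ℤ]
  [∀ n : ℤ, (shiftFunctor T n).Additive] [Pretriangulated T] [Linear K T]

/-- Fully faithful exact `K`-linear functors `A ⥤ T`. -/
structure FFEFunctor where
  functor : A ⥤ T
  [commShift : functor.CommShift ℤ]
  [exact : functor.IsTriangulated]
  [full : functor.Full]
  [faithful : functor.Faithful]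
  [linear : functor.Linear K]

attribute [instance] FFEFunctor.commShift FFEFunctor.exact FFEFunctor.full
  FFEFunctor.faithful FFEFunctor.linear

/-- Exact auto-equivalences of `A`. -/
structure ExactAutoequivalence where
  functor : A ⥤ A
  [commShift : functor.CommShift ℤ]
  [exact : functor.IsTriangulated]
  [isEquivalence : functor.IsEquivalence]

attribute [instance] ExactAutoequivalence.commShift ExactAutoequivalence.exact
  ExactAutoequivalence.isEquivalence

variable {K A T}

/-- `F ∼ F'` if `F ∘ α ≅ F'` for some exact auto-equivalence `α` of `A`, where `≅` is an
isomorphism of exact functors, i.e. a natural isomorphism compatible with the shifts. -/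
def FFEFunctor.Equiv (F F' : FFEFunctor K A T) : Prop :=
  ∃ (α : ExactAutoequivalence A) (e : α.functor ⋙ F.functor ≅ F'.functor),
    NatTrans.CommShift e.hom ℤ

theorem FFEFunctor.Equiv.refl (F : FFEFunctor K A T) : F.Equiv F :=
  ⟨⟨𝟭 A⟩, F.functor.leftUnitor, inferInstance⟩

theorem FFEFunctor.Equiv.symm {F F' : FFEFunctor K A T} (h : F.Equiv F') : F'.Equiv F := by
  obtain ⟨α, e, he⟩ := h
  let E : A ≌ A := α.functor.asEquivalence
  let _ : E.functor.CommShift ℤ := α.commShift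
  have : E.functor.IsTriangulated := α.exact
  let _ : E.inverse.CommShift ℤ := E.commShiftInverse ℤ
  have : E.CommShift ℤ := E.commShift_of_functor ℤ
  have : E.IsTriangulated := Equivalence.IsTriangulated.mk' E inferInstance
  let e' : E.functor ⋙ F.functor ≅ F'.functor := e
  have he' : NatTrans.CommShift e'.hom ℤ := he
  let i : E.inverse ⋙ F'.functor ≅ F.functor :=
    Functor.isoWhiskerLeft E.inverse e'.symm ≪≫
      (Functor.associator E.inverse E.functor F.functor).symm ≪≫
      Functor.isoWhiskerRight E.counitIso F.functor ≪≫ F.functor.leftUnitor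
  refine ⟨⟨E.inverse⟩, i, ?_⟩
  dsimp [i]
  infer_instance

theorem FFEFunctor.Equiv.trans {F F' F'' : FFEFunctor K A T} (h : F.Equiv F')
    (h' : F'.Equiv F'') : F.Equiv F'' := by
  obtain ⟨α, e, he⟩ := h
  obtain ⟨β, e', he'⟩ := h'
  let i : (β.functor ⋙ α.functor) ⋙ F.functor ≅ F''.functor :=
    Functor.associator _ _ _ ≪≫ Functor.isoWhiskerLeft β.functor e ≪≫ e'
  refine ⟨⟨β.functor ⋙ α.functor⟩, i, ?_⟩
  dsimp [i]
  infer_instance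

variable (K A T) in
/-- The equivalence relation `∼` (for the trivial group of auto-equivalences of `T`). -/
instance FFEFunctor.setoid : Setoid (FFEFunctor K A T) where
  r := FFEFunctor.Equiv
  iseqv := ⟨FFEFunctor.Equiv.refl, FFEFunctor.Equiv.symm, FFEFunctor.Equiv.trans⟩

/-- Equivalent functors have the same essential image. -/
theorem FFEFunctor.Equiv.essImage_eq {F F' : FFEFunctor K A T} (h : F.Equiv F') :
    F.functor.essImage = F'.functor.essImage := by
  obtain ⟨α, e, _⟩ := h
  ext X
  constructor
  · rintro ⟨Y, ⟨i⟩⟩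
    exact ⟨α.functor.objPreimage Y,
      ⟨(e.app _).symm ≪≫ F.functor.mapIso (α.functor.objObjPreimageIso Y) ≪≫ i⟩⟩
  · rintro ⟨Y, ⟨i⟩⟩
    exact ⟨α.functor.obj Y, ⟨e.app Y ≪≫ i⟩⟩

end Curves

section CurvesNP

variable (K : Type w) [Field K] (l : ℤ)
  (T : Type u) [Category.{v} T] [Preadditive T] [HasZeroObject T] [HasShift T ℤ]
  [∀ n : ℤ, (shiftFunctor T n).Additive] [Pretriangulated T] [Linear K T]

/-- `C_l(T)`: the non-commutative curves of genus `l` in `T`, i.e. the equivalence classes of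
fully faithful exact `K`-linear functors `N𝐏^l ⥤ T`. -/
def NCCurve := Quotient (FFEFunctor.setoid K (NP K l) T)

variable {K l T}

/-- The full subcategory `Im(F)` of `T` determined by a non-commutative curve `[F]`. -/
def NCCurve.image (𝒜 : NCCurve K l T) : ObjectProperty T :=
  Quotient.lift (fun F : FFEFunctor K (NP K l) T => F.functor.essImage)
    (fun _ _ h => FFEFunctor.Equiv.essImage_eq h) 𝒜

/-- `C'_{l,σσ}(T)`: the functors `F : N𝐏^l ⥤ T` such that `F(E)` is `σ`-semistable for all `E`
in the given system `𝓔` of exceptional objects of `N𝐏^l`. -/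
def stableFunctors (𝓔 : Set (NP K l)) (σ : Stab T) : Set (FFEFunctor K (NP K l) T) :=
  {F | ∀ E ∈ 𝓔, F.functor.obj E ∈ σ.semistable}

/-- `C_{l,σσ}(T) ⊆ C_l(T)`: the `σ`-stable non-commutative curves of genus `l` in `T`. -/
def stableNCCurves (𝓔 : Set (NP K l)) (σ : Stab T) : Set (NCCurve K l T) :=
  Quotient.mk (FFEFunctor.setoid K (NP K l) T) '' stableFunctors 𝓔 σ

end CurvesNP

/-!
A nonzero object `E` is `σ`-semistable exactly when `φ⁺(E) = φ⁻(E)`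
(`Slicing.exists_mem_iff_phiPlus_eq_phiMinus`). If `E` lies in `P(t)`, then the first
Harder-Narasimhan factor of `E` maps nontrivially to `E`, because no map from it is killed along
the filtration, so `φ⁺(E) ≤ t`; and `E` maps nontrivially to the last factor, so `t ≤ φ⁻(E)`.
On a basic neighbourhood `B_ε(σ)` the numbers `φ⁺(E)` and `φ⁻(E)` move by less than `ε`, so
`φ⁺(E) ≠ φ⁻(E)` is an open condition and semistability of a fixed nonzero object is a closed one
(`Stab.isClosed_setOf_mem_semistable`).

For a curve `[F]`, full faithfulness of `F` identifies the exceptional objects of `Im(F)` with the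
images of the exceptional objects of `N𝐏^l`. Each of those is a shift of a member of `𝓔`, and
semistability is invariant under isomorphisms and shifts; so `[F]` is `σ`-stable if and only if
all exceptional objects of `Im(F)` are `σ`-semistable. This exhibits the locus of `σ`-stability of
the curve as an intersection of closed sets.
-/

/-! ### Semistability of a fixed object -/

section SemistableLocus

variable {T : Type u} [Category.{v} T] [Preadditive T] [HasZeroObject T] [HasShift T ℤ]
  [∀ n : ℤ, (shiftFunctor T n).Additive] [Pretriangulated T]

namespace Slicing

variable (S : Slicing T)

theorem mem_of_iso {φ : ℝ} {X Y : T} (e : X ≅ Y) (h : S.P φ X) : S.P φ Y :=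
  have := S.closedIso φ
  (S.P φ).prop_of_iso e h

theorem mem_shift_neg_one {φ : ℝ} {X : T} (h : S.P φ X) : S.P (φ - 1) (X⟦(-1 : ℤ)⟧) := by
  rw [← S.shift, sub_add_cancel]
  exact S.mem_of_iso ((shiftFunctorCompIsoId T (-1 : ℤ) 1 (by simp)).app X).symm h

theorem mem_shift {φ : ℝ} {X : T} (h : S.P φ X) (k : ℤ) : S.P (φ + k) (X⟦k⟧) := by
  induction k with
  | zero => simpa using S.mem_of_iso ((shiftFunctorZero T ℤ).app X).symm h
  | succ i ih =>
    have h' := S.mem_of_iso ((shiftFunctorAdd T (i : ℤ) 1).app X).symm ((S.shift _ _).2 ih)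
    convert h' using 1
    push_cast
    ring
  | pred i ih =>
    have h' := S.mem_of_iso ((shiftFunctorAdd' T (-i : ℤ) (-1) (-i - 1) (by ring)).app X).symm
      (S.mem_shift_neg_one ih)
    convert h' using 1
    push_cast
    ring

end Slicing

namespace HNFiltration

variable {S : Slicing T} {E : T} (F : HNFiltration S.P E)

/-- The `i`-th step of the filtration is built from the factors before it, so it has no maps to an
object of phase below all of theirs. -/
theorem hom_obj_eq_zero {ψ : ℝ} {Y : T} (hY : S.P ψ Y) (i : Fin (F.n + 2))
    (h : ∀ j : Fin (F.n + 1), j.castSucc < i → ψ < F.phase j) (f : F.obj i ⟶ Y) : f = 0 := by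
  induction i using Fin.induction with
  | zero => exact F.zero.eq_of_src _ _
  | succ i ih =>
    have h0 : F.incl i ≫ f = 0 :=
      ih (fun j hj => h j (hj.trans Fin.castSucc_lt_succ)) _
    obtain ⟨g, hg⟩ := Triangle.yoneda_exact₂ _ (F.dist i) f h0
    have hg0 : g = 0 := S.hom_zero _ _ _ _ (h i Fin.castSucc_lt_succ) (F.factor_mem i) hY g
    rw [hg, hg0]
    exact comp_zero

/-- The first factor is the first nonzero step of the filtration, and its inclusion is not killed
by any later step. -/
theorem exists_hom_factor_zero_ne_zero (i : Fin (F.n + 1)) :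
    ∃ g : F.factor 0 ⟶ F.obj i.succ, g ≠ 0 := by
  induction i using Fin.induction with
  | zero =>
    have : IsIso (F.proj 0) :=
      (Triangle.isZero₁_iff_isIso₂ _ (F.dist 0)).1 F.zero
    refine ⟨inv (F.proj 0), fun h => F.factor_ne 0 ?_⟩
    rw [IsZero.iff_id_eq_zero, ← IsIso.inv_hom_id (F.proj 0), h, zero_comp]
  | succ i ih =>
    obtain ⟨g, hg⟩ := ih
    refine ⟨g ≫ F.incl i.succ, fun h => hg ?_⟩
    -- A map killed by `incl` lifts to the shifted factor `A_{i+1}[-1]`, of phase below `φ₀`.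
    obtain ⟨k, hk⟩ := Triangle.coyoneda_exact₂ _
      (inv_rot_of_distTriang _ (F.dist i.succ)) g h
    have hlt : F.phase i.succ - 1 < F.phase 0 := by
      have := F.phase_anti (Fin.succ_pos i)
      linarith
    have hk0 : k = 0 := S.hom_zero _ _ _ _ hlt (F.factor_mem 0)
      (S.mem_shift_neg_one (F.factor_mem i.succ)) k
    rw [hk, hk0]
    exact zero_comp

theorem proj_last_ne_zero : F.proj (Fin.last F.n) ≠ 0 := by
  intro h
  -- If `proj` vanishes, the identity of the last factor `A_n` factors through `E_n[1]`, all of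
  -- whose phases exceed that of `A_n`.
  obtain ⟨g, hg⟩ := Triangle.yoneda_exact₃ _ (F.dist (Fin.last F.n)) (𝟙 (F.factor _))
    (show F.proj _ ≫ 𝟙 _ = 0 by rw [h, zero_comp])
  have hg0 : g⟦(-1 : ℤ)⟧' = 0 := by
    rw [← cancel_epi ((shiftFunctorCompIsoId T (1 : ℤ) (-1) (by simp)).inv.app _), comp_zero]
    refine F.hom_obj_eq_zero (S.mem_shift_neg_one (F.factor_mem (Fin.last F.n))) _
      (fun j hj => ?_) _
    have := F.phase_anti (show j < Fin.last F.n from hj)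
    linarith
  have hg1 : g = 0 := (shiftFunctor T (-1 : ℤ)).map_injective (by rw [hg0, Functor.map_zero])
  refine F.factor_ne (Fin.last F.n) ((IsZero.iff_id_eq_zero _).2 ?_)
  rw [hg1, comp_zero] at hg
  exact hg

theorem phase_zero_le {t : ℝ} (hE : S.P t E) : F.phase 0 ≤ t := by
  by_contra! ht
  obtain ⟨g, hg⟩ := F.exists_hom_factor_zero_ne_zero (Fin.last F.n)
  exact hg (S.hom_zero _ _ _ _ ht (F.factor_mem 0) (S.mem_of_iso F.top.symm hE) g)

theorem le_phase_last {t : ℝ} (hE : S.P t E) : t ≤ F.phase (Fin.last F.n) := by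
  by_contra! ht
  exact F.proj_last_ne_zero
    (S.hom_zero _ _ _ _ ht (S.mem_of_iso F.top.symm hE) (F.factor_mem _) _)

theorem mem_of_phase_eq (h : F.phase 0 = F.phase (Fin.last F.n)) : S.P (F.phase 0) E := by
  have h0 : (0 : Fin (F.n + 1)) = Fin.last F.n := F.phase_anti.injective h
  have h1 : (0 : Fin (F.n + 1)).succ = Fin.last (F.n + 1) := by rw [h0, Fin.succ_last]
  have : IsIso (F.proj 0) := (Triangle.isZero₁_iff_isIso₂ _ (F.dist 0)).1 F.zero
  exact S.mem_of_iso ((asIso (F.proj 0)).symm ≪≫ eqToIso (congrArg F.obj h1) ≪≫ F.top)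
    (F.factor_mem 0)

end HNFiltration

namespace Slicing

theorem exists_mem_iff_phiPlus_eq_phiMinus (S : Slicing T) {E : T} (hE : ¬ IsZero E) :
    (∃ t, S.P t E) ↔ S.phiPlus E = S.phiMinus E := by
  simp only [phiPlus, phiMinus, dif_neg hE]
  constructor
  · rintro ⟨t, ht⟩
    exact le_antisymm (((S.hn E hE).phase_zero_le ht).trans ((S.hn E hE).le_phase_last ht))
      ((S.hn E hE).phase_anti.antitone (Fin.zero_le _))
  · exact fun h => ⟨_, (S.hn E hE).mem_of_phase_eq h⟩

theorem dist_self (S : Slicing T) : S.dist S = 0 := by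
  simp [dist]

theorem abs_sub_lt_of_dist_lt {S S' : Slicing T} {ε : ℝ} (h : S.dist S' < ENNReal.ofReal ε)
    {E : T} (hE : ¬ IsZero E) :
    |S.phiMinus E - S'.phiMinus E| < ε ∧ |S.phiPlus E - S'.phiPlus E| < ε := by
  have h1 := (le_iSup₂ (f := fun (E : T) (_ : ¬ IsZero E) => ENNReal.ofReal
    (max |S.phiMinus E - S'.phiMinus E| |S.phiPlus E - S'.phiPlus E|)) E hE).trans_lt h
  exact max_lt_iff.1 ((ENNReal.ofReal_lt_ofReal_iff_of_nonneg (by positivity)).1 h1)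

end Slicing

namespace Stab

theorem mem_ball_self (σ : Stab T) {ε : ℝ} (h0 : 0 < ε) (h1 : ε < 1) : σ ∈ σ.ball ε := by
  constructor
  · have : 0 < Real.sin (Real.pi * ε) :=
      Real.sin_pos_of_pos_of_lt_pi (by positivity) (by nlinarith [Real.pi_pos])
    simpa [seminorm] using this
  · simpa [Slicing.dist_self] using h0

/-- Semistability of a fixed nonzero object is a closed condition. -/
theorem isClosed_setOf_mem_semistable {E : T} (hE : ¬ IsZero E) :
    IsClosed {σ : Stab T | E ∈ σ.semistable} := by
  rw [← isOpen_compl_iff, isOpen_iff_forall_mem_open]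
  intro σ hσ
  have hne : σ.slicing.phiPlus E - σ.slicing.phiMinus E ≠ 0 := fun h =>
    hσ ⟨hE, (σ.slicing.exists_mem_iff_phiPlus_eq_phiMinus hE).2 (sub_eq_zero.1 h)⟩
  have hpos := abs_pos.2 hne
  -- Half the gap `φ⁺ - φ⁻`, so that the two phases cannot meet on the ball.
  obtain ⟨ε, hε0, hε⟩ :=
    exists_between (lt_min (half_pos hpos) (by norm_num : (0 : ℝ) < 1 / 8))
  obtain ⟨hε1, hε2⟩ := lt_min_iff.1 hε
  refine ⟨σ.ball ε, fun τ hτ hτE => ?_, TopologicalSpace.isOpen_generateFrom_of_mem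
    ⟨σ, ε, hε0, hε2, rfl⟩, σ.mem_ball_self hε0 (by linarith)⟩
  have heq := (τ.slicing.exists_mem_iff_phiPlus_eq_phiMinus hE).1 hτE.2
  obtain ⟨hm, hp⟩ := Slicing.abs_sub_lt_of_dist_lt hτ.2 hE
  have := abs_sub (σ.slicing.phiPlus E - τ.slicing.phiPlus E)
    (σ.slicing.phiMinus E - τ.slicing.phiMinus E)
  rw [heq, sub_sub_sub_cancel_right] at this
  rw [heq] at hp
  linarith

theorem mem_semistable_of_iso {σ : Stab T} {X Y : T} (e : X ≅ Y) (h : X ∈ σ.semistable) :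
    Y ∈ σ.semistable :=
  ⟨fun hY => h.1 (hY.of_iso e), h.2.imp fun _ ht => σ.slicing.mem_of_iso e ht⟩

theorem shift_mem_semistable {σ : Stab T} {X : T} (h : X ∈ σ.semistable) (k : ℤ) :
    X⟦k⟧ ∈ σ.semistable := by
  obtain ⟨h0, t, ht⟩ := h
  refine ⟨fun hX => h0 ?_, _, σ.slicing.mem_shift ht k⟩
  rw [IsZero.iff_id_eq_zero] at hX ⊢
  exact (shiftFunctor T k).map_injective (by
    rw [CategoryTheory.Functor.map_id, hX, Functor.map_zero])

end Stab

end SemistableLocus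

/-! ### Exceptional objects and fully faithful functors -/

section ExceptionalTransport

variable {K : Type w} [Field K]

theorem IsExceptional.not_isZero {T : Type u} [Category.{v} T] [Preadditive T] [HasShift T ℤ]
    [Linear K T] {E : T} (h : IsExceptional K E) : ¬ IsZero E := by
  intro hE
  have : Subsingleton (E ⟶ E) := ⟨fun _ _ => hE.eq_of_src _ _⟩
  have h1 := h.1
  rw [Module.finrank_zero_of_subsingleton] at h1
  exact zero_ne_one h1

theorem IsExceptional.of_iso {T : Type u} [Category.{v} T] [Preadditive T] [HasShift T ℤ]
    [Linear K T] {X Y : T} (e : X ≅ Y) (h : IsExceptional K X) : IsExceptional K Y := by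
  refine ⟨(Linear.homCongr K e e).finrank_eq.symm.trans h.1, fun i hi f => ?_⟩
  have := h.2 i hi (e.hom ≫ f ≫ e.inv⟦i⟧')
  rw [← cancel_epi e.hom, ← cancel_mono (e.inv⟦i⟧'), Category.assoc, this]
  simp

variable {A : Type u'} [Category.{v'} A] [Preadditive A] [HasZeroObject A] [HasShift A ℤ]
  [∀ n : ℤ, (shiftFunctor A n).Additive] [Pretriangulated A] [Linear K A]
  {T : Type u} [Category.{v} T] [Preadditive T] [HasZeroObject T] [HasShift T ℤ]
  [∀ n : ℤ, (shiftFunctor T n).Additive] [Pretriangulated T] [Linear K T]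

theorem FFEFunctor.isExceptional_obj_iff (F : FFEFunctor K A T) {X : A} :
    IsExceptional K (F.functor.obj X) ↔ IsExceptional K X := by
  have e : (X ⟶ X) ≃ₗ[K] (F.functor.obj X ⟶ F.functor.obj X) :=
    LinearEquiv.ofBijective (F.functor.mapLinearMap K)
      ⟨F.functor.map_injective, F.functor.map_surjective⟩
  refine and_congr (by rw [e.finrank_eq]) (forall₂_congr fun i _ => ?_)
  constructor
  · intro h f
    apply F.functor.map_injective
    rw [← cancel_mono ((F.functor.commShiftIso i).hom.app X), h (_ ≫ _), Functor.map_zero,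
      zero_comp]
  · intro h f
    obtain ⟨g, hg⟩ := F.functor.map_surjective (f ≫ (F.functor.commShiftIso i).inv.app X)
    rw [← cancel_mono ((F.functor.commShiftIso i).inv.app X), ← hg, h g, Functor.map_zero,
      zero_comp]

end ExceptionalTransport

/-! ### Stability of curves -/

theorem NCCurve.mem_stableNCCurves_iff {K : Type w} [Field K]
    {T : Type u} [Category.{v} T] [Preadditive T] [HasZeroObject T] [HasShift T ℤ]
    [∀ n : ℤ, (shiftFunctor T n).Additive] [Pretriangulated T] [Linear K T]
    {l : ℤ} {𝓔 : Set (NP K l)} (h𝓔 : IsExceptionalSystem K 𝓔) (𝒜 : NCCurve K l T)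
    (σ : Stab T) :
    𝒜 ∈ stableNCCurves 𝓔 σ ↔ ∀ E : T, IsExceptional K E → 𝒜.image E → E ∈ σ.semistable := by
  constructor
  · rintro ⟨F, hF, rfl⟩ E hE ⟨Y, ⟨e⟩⟩
    have hY : IsExceptional K Y := F.isExceptional_obj_iff.1 (hE.of_iso e.symm)
    obtain ⟨X, ⟨hX, k, ⟨i⟩⟩, -⟩ := h𝓔.2 Y hY
    exact Stab.mem_semistable_of_iso
      ((F.functor.commShiftIso k).symm.app X ≪≫ F.functor.mapIso i.symm ≪≫ e)
      (Stab.shift_mem_semistable (hF X hX) k)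
  · intro h
    obtain ⟨F, rfl⟩ := Quotient.exists_rep 𝒜
    exact ⟨F, fun X hX => h _ (F.isExceptional_obj_iff.2 (h𝓔.1 X hX))
      ⟨X, ⟨Iso.refl _⟩⟩, rfl⟩

theorem corollary4p7 {K : Type w} [Field K]
    {T : Type u} [Category.{v} T] [Preadditive T] [HasZeroObject T] [HasShift T ℤ]
    [∀ n : ℤ, (shiftFunctor T n).Additive] [Pretriangulated T] [IsTriangulated T]
    [Linear K T] [∀ n : ℤ, (shiftFunctor T n).Linear K]
    (l : ℤ) (hl : -1 ≤ l) (𝓔 : Set (NP K l)) (h𝓔 : IsExceptionalSystem K 𝓔)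
    (𝒜 : NCCurve K l T) :
    IsClosed {σ : Stab T | 𝒜 ∈ stableNCCurves 𝓔 σ} ∧
    (∀ E : T, IsExceptional K E → 𝒜.image E → IsClosed {σ : Stab T | E ∈ σ.semistable}) ∧
    {σ : Stab T | 𝒜 ∈ stableNCCurves 𝓔 σ} =
      ⋂ E ∈ {E : T | IsExceptional K E ∧ 𝒜.image E}, {σ : Stab T | E ∈ σ.semistable} := by
  have heq : {σ : Stab T | 𝒜 ∈ stableNCCurves 𝓔 σ} =
      ⋂ E ∈ {E : T | IsExceptional K E ∧ 𝒜.image E}, {σ : Stab T | E ∈ σ.semistable} := by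
    ext σ
    simp only [Set.mem_ofPred_eq, Set.mem_iInter, and_imp]
    exact 𝒜.mem_stableNCCurves_iff h𝓔 σ
  refine ⟨?_, fun E hE _ => Stab.isClosed_setOf_mem_semistable hE.not_isZero, heq⟩
  rw [heq]
  exact isClosed_biInter fun E hE => Stab.isClosed_setOf_mem_semistable hE.1.not_isZero
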